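/- Let $p$ be a prime and $k$ an algebraically closed field of characteristic $p$. Let $X,Y,H$ be the standard basis of $\mathfrak{sl}_2(\mathbb{C})$ (so $[H,X]=2X$, $[H,Y]=-2Y$, $[X,Y]=H$), let $\mathcal{U}_{\mathbb{Z}}$ be the subring of the universal enveloping algebra of $\mathfrak{sl}_2(\mathbb{C})$ generated by all $X^{(m)}=X^m/m!$ and $Y^{(m)}=Y^m/m!$ with $m\ge 0$, and let $\mathcal{U}=\mathcal{U}_{\mathbb{Z}}\otimes_{\mathbb{Z}}k$ be the hyperalgebra of $\mathrm{SL}_2(k)$. For $c\in\mathbb{Z}$ and $n\ge 0$ put $\binom{H+c}{n}=(H+c)(H+c-1)\cdots(H+c-n+1)/n!\in\mathcal{U}_{\mathbb{Z}}$; the same notation is used for the images of elements of $\mathcal{U}_{\mathbb{Z}}$ in $\mathcal{U}$. The elements $Y^{(m)}\binom{H}{n}X^{(m')}$ $(m,n,m'\ge 0)$ form a $k$-basis of $\mathcal{U}$; let $\mathrm{Fr}':\mathcal{U}\to\mathcal{U}$ be the $k$-linear map with $Y^{(m)}\binom{H}{n}X^{(m')}\mapsto Y^{(mp)}\binom{H}{np}X^{(m'p)}$.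 For $a\in\mathbb{Z}$ put $\mu_a=\binom{H-a-1}{p-1}\in\mathcal{U}$. *Parameters.* If $p$ is odd, let $\mathcal{P}=\{0,\dots,p-1\}\times\{0,\dots,(p-1)/2\}$; if $p=2$, let $\mathcal{P}=\{(0,1/2),(1,0),(1,1)\}$. *The elements $B^{(\varepsilon)}(a,j)$ for $(a,j)\in\mathcal{P}$, $\varepsilon\in\{0,1\}$.* If $p$ is odd, define in $\mathbb{F}_p[x]$ the polynomials $\varphi_{a,m}(x)=\prod_{i=0}^{m-1}(x-i(i+a+1))$, $\psi(x)=\prod_{i\in\mathbb{F}_p}(x-i^2)$, $\psi^{(1)}_j(x)=\psi(x)/(x-j^2)$, $\psi_0^{(0)}(x)=\prod_{i\in\mathbb{F}_p^\times}(x-i^2)$ and, for $j\ne0$, $\psi_j^{(0)}(x)=2x(x+j^2)\prod_{i\in\mathbb{F}_p^\times\setminus\{j,-j\}}(x-i^2)$; set $$B^{(\varepsilon)}(a,j)=\psi_j^{(\varepsilon)}\Big(\mu_aYX+\big(\tfrac{a+1}{2}\big)^2\Big)\mu_a,$$ and let $n^{(\varepsilon)}(a,j)$ be the largest $n\ge0$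 with $\varphi_{a,n}(x)\mid\psi_j^{(\varepsilon)}\big(x+(\tfrac{a+1}{2})^2\big)$. If $p=2$, set $B^{(0)}(0,\frac12)=\mu_0$, $B^{(1)}(0,\frac12)=\mu_0YX$, $B^{(\varepsilon)}(1,0)=\mu_1YX$, $B^{(\varepsilon)}(1,1)=\mu_1YX+\mu_1$, and $n^{(\varepsilon)}(0,\frac12)=\varepsilon$, $n^{(\varepsilon)}(1,0)=1$, $n^{(\varepsilon)}(1,1)=0$. In all cases there are unique $c_m^{(\varepsilon)}\in\mathbb{F}_p$ with $B^{(\varepsilon)}(a,j)=\mu_a\sum_{m=n^{(\varepsilon)}(a,j)}^{p-1}c^{(\varepsilon)}_mY^mX^m$. *The maps $Z^{(\varepsilon)}$.* Consider the conditions (A): $a$ is even and $(p-a+1)/2\le j\le(p-1)/2$; (C): $a$ is odd and $0\le j\le(a-1)/2$. If $(a,j)\in\mathcal{P}$ satisfies (A) or (C), let $s(a,j)$ be $(p-a+1)/2$ if $p$ is odd and $a$ is even, $(p-a)/2$ if $p$ and $a$ are odd, and $1$ if $p=2$, and put $$Z^{(\varepsilon)}(z;(a,j))=\mu_a\sum_{m=n^{(\varepsilon)}(a,j)}^{p-1}c_m^{(\varepsilon)}Y^mX^{m-s(a,j)}\,\mathrm{Fr}'(z)\,X^{s(a,j)}\qquad(z\in\mathcal{U});$$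 otherwise put $Z^{(\varepsilon)}(z;(a,j))=\mathrm{Fr}'(z)B^{(\varepsilon)}(a,j)$. *The elements $B^{(\boldsymbol\varepsilon)}(\boldsymbol a,\boldsymbol j)$.* For $r\ge1$, $\boldsymbol\varepsilon=(\varepsilon_0,\dots,\varepsilon_{r-1})\in\{0,1\}^r$ and $(\boldsymbol a,\boldsymbol j)=((a_i,j_i))_{i=0}^{r-1}\in\mathcal{P}^r$, let $B^{(\boldsymbol\varepsilon)}(\boldsymbol a,\boldsymbol j)=B^{(\varepsilon_0)}(a_0,j_0)$ if $r=1$, and $$B^{(\boldsymbol\varepsilon)}(\boldsymbol a,\boldsymbol j)=Z^{(\varepsilon_0)}\Big(B^{(\varepsilon_1,\dots,\varepsilon_{r-1})}\big((a_1,\dots,a_{r-1}),(j_1,\dots,j_{r-1})\big);(a_0,j_0)\Big)$$ if $r\ge2$. **Proposition.** Let $r\ge1$, $\boldsymbol\varepsilon,\tilde{\boldsymbol\varepsilon}\in\{0,1\}^r$ and $(\boldsymbol a,\boldsymbol j)\in\mathcal{P}^r$. If $\varepsilon_s=\tilde\varepsilon_s$ for every $s\in\{0,\dots,r-1\}$ with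 $j_s\ne0$ (when $p$ is odd), respectively with $a_s\ne1$ (when $p=2$), then $$B^{(\boldsymbol\varepsilon)}(\boldsymbol a,\boldsymbol j)=B^{(\tilde{\boldsymbol\varepsilon})}(\boldsymbol a,\boldsymbol j).$$ In particular, $B^{(\boldsymbol\varepsilon)}(\boldsymbol a,\boldsymbol j)$ does not change if every $\varepsilon_s$ with $j_s=0$ ($p$ odd), respectively with $a_s=1$ ($p=2$), is replaced by $0$. -/

import Mathlib

noncomputable section
namespace SL2Hyper
open Polynomial
open scoped Nat TensorProduct

section DividedPowers
variable {A : Type*} [Ring A] [Algebra ℂ A]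

/-- The divided power `x ^ m / m!`. -/
def divPow (x : A) (m : ℕ) : A := ((m ! : ℂ)⁻¹) • x ^ m

/-- The binomial coefficient `x (x - 1) ⋯ (x - n + 1) / n!`. -/
def binom (x : A) (n : ℕ) : A := ((n ! : ℂ)⁻¹) • aeval x (descPochhammer ℂ n)

/-- Divided powers extended by zero to negative exponents (auxiliary). -/
def divPowZ (x : A) : ℤ → A
  | (m : ℕ) => divPow x m
  | Int.negSucc _ => 0

theorem divPowZ_natCast (x : A) (m : ℕ) : divPowZ x (m : ℤ) = divPow x m := rfl

theorem divPowZ_neg_one (x : A) : divPowZ x (-1) = 0 := rfl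

theorem divPow_zero (x : A) : divPow x 0 = 1 := by simp [divPow]

theorem divPow_one (x : A) : divPow x 1 = x := by simp [divPow]

theorem binom_zero (x : A) : binom x 0 = 1 := by simp [binom]

theorem mul_divPow (x : A) (m : ℕ) : x * divPow x m = ((m : ℂ) + 1) • divPow x (m + 1) := by
  have h : ((m : ℂ) + 1) ≠ 0 := by exact_mod_cast Nat.succ_ne_zero m
  simp only [divPow, mul_smul_comm, smul_smul, Nat.factorial_succ, pow_succ']
  congr 1
  push_cast
  field_simp

theorem divPow_mul (x : A) (m : ℕ) : divPow x m * x = ((m : ℂ) + 1) • divPow x (m + 1) := by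
  rw [← mul_divPow]
  simp only [divPow, mul_smul_comm, smul_mul_assoc, ← pow_succ, ← pow_succ']

theorem mul_divPowZ (x : A) (m : ℤ) : x * divPowZ x m = ((m : ℂ) + 1) • divPowZ x (m + 1) := by
  match m with
  | (m : ℕ) =>
    rw [← Nat.cast_succ, divPowZ_natCast, divPowZ_natCast, mul_divPow]; simp
  | Int.negSucc 0 => simp [divPowZ]
  | Int.negSucc (n + 1) =>
    have : Int.negSucc (n + 1) + 1 = Int.negSucc n := by omega
    rw [this]; simp [divPowZ]

theorem divPow_mul_divPow (x : A) (i m : ℕ) :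
    divPow x i * divPow x m = (((i + m).choose i : ℕ) : ℤ) • divPow x (i + m) := by
  rw [← Int.cast_smul_eq_zsmul ℂ]
  simp only [divPow, mul_smul_comm, smul_mul_assoc, smul_smul, ← pow_add]
  congr 1
  have h1 : ((i ! : ℕ) : ℂ) ≠ 0 := by exact_mod_cast i.factorial_ne_zero
  have h2 : ((m ! : ℕ) : ℂ) ≠ 0 := by exact_mod_cast m.factorial_ne_zero
  have h3 : (((i + m)! : ℕ) : ℂ) ≠ 0 := by exact_mod_cast (i + m).factorial_ne_zero
  have := Nat.add_choose_mul_factorial_mul_factorial i m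
  have h : (((i + m).choose i : ℕ) : ℂ) * (i ! : ℕ) * (m ! : ℕ) = ((i + m)! : ℕ) := by
    rw [← Nat.choose_symm_add] at this; exact_mod_cast this
  field_simp
  push_cast
  linear_combination -h

theorem succ_smul_binom_succ (x : A) (n : ℕ) :
    ((n : ℂ) + 1) • binom x (n + 1) = binom x n * (x - (n : A)) := by
  have h : ((n : ℂ) + 1) ≠ 0 := by exact_mod_cast Nat.succ_ne_zero n
  simp only [binom, descPochhammer_succ_right, smul_smul, Nat.factorial_succ, map_mul,
    smul_mul_assoc, map_sub, aeval_X, map_natCast]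
  congr 1
  push_cast
  field_simp

theorem binom_succ (x : A) (n : ℕ) :
    binom x (n + 1) = ((n : ℂ) + 1)⁻¹ • (binom x n * (x - (n : A))) := by
  have h : ((n : ℂ) + 1) ≠ 0 := by exact_mod_cast Nat.succ_ne_zero n
  rw [← succ_smul_binom_succ, smul_smul, inv_mul_cancel₀ h, one_smul]

theorem binom_add_one (x : A) (n : ℕ) :
    binom (x + 1) (n + 1) = binom x (n + 1) + binom x n := by
  have h : ((n : ℂ) + 1) ≠ 0 := by exact_mod_cast Nat.succ_ne_zero n
  have h2 : ((n ! : ℕ) : ℂ) ≠ 0 := by exact_mod_cast n.factorial_ne_zero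
  have key : aeval (x + 1) (descPochhammer ℂ (n + 1)) = (x + 1) * aeval x (descPochhammer ℂ n) := by
    rw [descPochhammer_succ_left, map_mul, aeval_X, aeval_comp]
    simp
  have key2 : (aeval x (descPochhammer ℂ n)) * x = x * aeval x (descPochhammer ℂ n) := by
    have := congrArg (aeval x) (mul_comm (descPochhammer ℂ n) X)
    simpa using this
  rw [binom_succ x n]
  have e : ((n ! : ℕ) : ℂ)⁻¹ = (((n + 1)! : ℕ) : ℂ)⁻¹ * ((n : ℂ) + 1) := by
    rw [Nat.factorial_succ]; push_cast; field_simp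
  have e' : ((n : ℂ) + 1)⁻¹ * ((n ! : ℕ) : ℂ)⁻¹ = (((n + 1)! : ℕ) : ℂ)⁻¹ := by
    rw [e]; field_simp
  rw [binom, binom, key, smul_mul_assoc, smul_smul, e', e, mul_smul, ← smul_add]
  congr 1
  rw [mul_sub, key2, add_smul, one_smul, add_mul, one_mul, ← Nat.cast_comm, ← nsmul_eq_mul,
    Nat.cast_smul_eq_nsmul]
  abel

theorem commute_binom (x : A) (c : ℤ) (n : ℕ) : Commute x (binom (x + (c : A)) n) := by
  induction n with
  | zero => simp [binom_zero]
  | succ n ih =>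
    rw [binom_succ]
    refine Commute.smul_right (ih.mul_right ?_) _
    exact ((Commute.refl x).add_right (Int.cast_commute c x).symm).sub_right
      (Nat.cast_commute n x).symm

theorem binom_mul_binom_sub (x : A) (t i : ℕ) :
    binom x t * binom (x - (t : A)) i = (((t + i).choose t : ℕ) : ℤ) • binom x (t + i) := by
  have key : aeval x (descPochhammer ℂ t) * aeval (x - (t : A)) (descPochhammer ℂ i)
      = aeval x (descPochhammer ℂ (t + i)) := by
    rw [← descPochhammer_mul, map_mul, aeval_comp]; simp
  rw [← Int.cast_smul_eq_zsmul ℂ]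
  simp only [binom, mul_smul_comm, smul_mul_assoc, smul_smul, key]
  congr 1
  have h1 : ((t ! : ℕ) : ℂ) ≠ 0 := by exact_mod_cast t.factorial_ne_zero
  have h2 : ((i ! : ℕ) : ℂ) ≠ 0 := by exact_mod_cast i.factorial_ne_zero
  have h3 : (((t + i)! : ℕ) : ℂ) ≠ 0 := by exact_mod_cast (t + i).factorial_ne_zero
  have := Nat.add_choose_mul_factorial_mul_factorial t i
  have h : (((t + i).choose t : ℕ) : ℂ) * (t ! : ℕ) * (i ! : ℕ) = ((t + i)! : ℕ) := by
    rw [← Nat.choose_symm_add] at this; exact_mod_cast this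
  field_simp
  push_cast
  linear_combination -h

/-- Any subgroup containing all `binom x n` contains all `binom (x + c) n` for integers `c`. -/
theorem binom_add_int_mem (S : AddSubgroup A) (x : A) (N : ℕ) (h : ∀ n ≤ N, binom x n ∈ S) (c : ℤ) :
    ∀ n ≤ N, binom (x + (c : A)) n ∈ S := by
  induction c using Int.induction_on with
  | zero => simpa using h
  | succ c ih =>
    intro n hn
    cases n with
    | zero => simpa [binom_zero] using h 0 (Nat.zero_le _)
    | succ n =>
      have : x + (((c : ℤ) + 1 : ℤ) : A) = (x + ((c : ℤ) : A)) + 1 := by push_cast; abel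
      rw [this, binom_add_one]
      exact S.add_mem (ih _ hn) (ih _ (by omega))
  | pred c ih =>
    intro n
    induction n with
    | zero => intro _; simpa [binom_zero] using h 0 (Nat.zero_le _)
    | succ n ih2 =>
      intro hn
      have e : x + ((-(c : ℤ) : ℤ) : A) = (x + ((-(c : ℤ) - 1 : ℤ) : A)) + 1 := by push_cast; abel
      have := binom_add_one (x + ((-(c : ℤ) - 1 : ℤ) : A)) n
      rw [← e] at this
      rw [← sub_eq_of_eq_add this]
      exact S.sub_mem (ih _ hn) (ih2 (by omega))

end DividedPowers

section Commutation
variable {A : Type*} [Ring A] [Algebra ℂ A] {x y h : A}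

theorem binom_semiconj {z : A} {k : ℤ} (hz : h * z = z * (h + (k : A))) (c : ℤ) (t : ℕ) :
    binom (h + (c : A)) t * z = z * binom (h + ((c + k : ℤ) : A)) t := by
  induction t with
  | zero => simp [binom_zero]
  | succ t ih =>
    have h1 : (h + (c : A) - (t : A)) * z = z * (h + ((c + k : ℤ) : A) - (t : A)) := by
      have e1 := (Int.cast_commute c z).eq
      have e2 := (Nat.cast_commute t z).eq
      rw [sub_mul, add_mul, hz, e1, e2]; push_cast; noncomm_ring
    rw [binom_succ, binom_succ, smul_mul_assoc, mul_assoc, h1, ← mul_assoc, ih, mul_assoc,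
      mul_smul_comm]

theorem semiconj_divPow {z : A} {k : ℤ} (hz : h * z = z * (h + (k : A))) (m : ℕ) :
    h * divPow z m = divPow z m * (h + ((m * k : ℤ) : A)) := by
  have : h * z ^ m = z ^ m * (h + ((m * k : ℤ) : A)) := by
    induction m with
    | zero => simp
    | succ m ih =>
      have e := (Int.cast_commute (m * k) z).eq
      rw [pow_succ, ← mul_assoc, ih, mul_assoc, add_mul, hz, e]
      push_cast; noncomm_ring
  rw [divPow, mul_smul_comm, this, smul_mul_assoc]

theorem x_mul_divPow_y (hy : h * y = y * (h + ((-2 : ℤ) : A))) (hxy : x * y = y * x + h) (m : ℤ) :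
    x * divPowZ y m = divPowZ y m * x + divPowZ y (m - 1) * (h - (m : A) + 1) := by
  match m with
  | Int.negSucc n =>
    have : Int.negSucc n - 1 = Int.negSucc (n + 1) := by omega
    rw [this]; simp [divPowZ]
  | (m : ℕ) =>
    induction m with
    | zero => simp [show divPowZ y 0 = 1 from divPow_zero y, divPowZ_neg_one]
    | succ m ih =>
      have hne : ((m : ℂ) + 1) ≠ 0 := by exact_mod_cast Nat.succ_ne_zero m
      have e1 : ((m : ℂ) + 1) • divPowZ y ((m + 1 : ℕ) : ℤ) = y * divPowZ y (m : ℤ) := by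
        rw [mul_divPowZ]; simp
      have e2 : y * divPowZ y ((m : ℤ) - 1) = (m : ℂ) • divPowZ y (m : ℤ) := by
        rw [mul_divPowZ]; simp
      have e3 := semiconj_divPow hy m
      refine (smul_right_injective A hne) ?_
      have s : ((m + 1 : ℕ) : ℤ) - 1 = m := by push_cast; ring
      simp only [s]
      have l : ((m : ℂ) + 1) • (x * divPowZ y ((m + 1 : ℕ) : ℤ)) = y * (x * divPowZ y (m : ℤ))
          + h * divPowZ y (m : ℤ) := by
        rw [← mul_smul_comm, e1, ← mul_assoc, hxy, add_mul, mul_assoc]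
      have r : ((m : ℂ) + 1) • (divPowZ y ((m + 1 : ℕ) : ℤ) * x) = y * divPowZ y (m : ℤ) * x := by
        rw [← smul_mul_assoc, e1]
      rw [l, smul_add, r, ih, mul_add, ← mul_assoc, ← mul_assoc, e2, add_assoc, divPowZ_natCast, e3,
        ← Nat.cast_succ, Nat.cast_smul_eq_nsmul, Nat.cast_smul_eq_nsmul,
        nsmul_eq_mul, nsmul_eq_mul, (Nat.cast_commute m (divPow y m)).eq, mul_assoc, mul_assoc,
        ← mul_assoc (m.succ : A), (Nat.cast_commute m.succ (divPow y m)).eq, mul_assoc]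
      congr 1
      have c := Nat.cast_comm m h
      have c' : ((m + 1 : ℕ) : A) * (h - (((m + 1 : ℕ) : ℤ) : A) + 1)
          = (m : A) * (h - ((m : ℤ) : A) + 1) + (h + ((m * -2 : ℤ) : A)) := by
        push_cast
        noncomm_ring
      rw [Nat.succ_eq_add_one, c', mul_add (divPow y m) ((m : A) * _)]

theorem commutation (hx : h * x = x * (h + ((2 : ℤ) : A))) (hy : h * y = y * (h + ((-2 : ℤ) : A)))
    (hxy : x * y = y * x + h) (i m : ℕ) :
    divPow x i * divPow y m = ∑ t ∈ Finset.range (i + 1),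
      divPowZ y ((m : ℤ) - t) * binom (h + ((2 * t - m - i : ℤ) : A)) t *
        divPowZ x ((i : ℤ) - t) := by
  induction i with
  | zero => simp [divPow_zero, binom_zero, divPowZ]
  | succ i ih =>
    have hne : ((i : ℂ) + 1) ≠ 0 := by exact_mod_cast Nat.succ_ne_zero i
    refine (smul_right_injective A hne) ?_
    simp only
    rw [← smul_mul_assoc, ← mul_divPow, mul_assoc, ih, Finset.mul_sum]
    let F : ℤ → A := fun t => divPowZ y ((m : ℤ) - t) *
      (((i : ℂ) + 1 - t) • binom (h + ((2 * t - m - i - 2 : ℤ) : A)) t.toNat) * divPowZ x (i + 1 - t)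
    let G : ℤ → A := fun t => divPowZ y ((m : ℤ) - t - 1) * ((h - ((m - t : ℤ) : A) + 1) *
      binom (h + ((2 * t - m - i : ℤ) : A)) t.toNat) * divPowZ x (i - t)
    have hterm : ∀ t : ℕ, x * (divPowZ y ((m : ℤ) - t) * binom (h + ((2 * t - m - i : ℤ) : A)) t *
        divPowZ x ((i : ℤ) - t)) = F t + G t := by
      intro t
      have b := binom_semiconj hx (2 * t - m - i - 2) t
      have s : (2 * t - m - i - 2 + 2 : ℤ) = 2 * t - m - i := by ring
      rw [s] at b
      simp only [F, G]
      rw [← mul_assoc, ← mul_assoc, x_mul_divPow_y hy hxy, add_mul, add_mul, mul_assoc _ x, ← b]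
      simp only [mul_assoc, mul_divPowZ, smul_mul_assoc, mul_smul_comm, Int.toNat_natCast]
      congr 1
      rw [show (i : ℤ) - t + 1 = i + 1 - t by ring]
      congr 1
      push_cast; ring
    rw [Finset.sum_congr rfl (fun t _ => hterm t), Finset.sum_add_distrib]
    have hF : ∑ t ∈ Finset.range (i + 1), F t = ∑ t ∈ Finset.range (i + 1 + 1), F t := by
      rw [Finset.sum_range_succ _ (i + 1)]; simp [F]
    have hG : ∑ t ∈ Finset.range (i + 1), G t
        = ∑ t ∈ Finset.range (i + 1 + 1), if t = 0 then 0 else G ((t : ℤ) - 1) := by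
      rw [Finset.sum_range_succ' _ (i + 1)]; simp
    rw [hF, hG, ← Finset.sum_add_distrib, Finset.smul_sum]
    refine Finset.sum_congr rfl fun t _ => ?_
    cases t with
    | zero => simp [F, binom_zero]
    | succ t =>
      simp only [F, G, Nat.succ_ne_zero, if_false]
      have s1 : (m : ℤ) - (((t + 1 : ℕ) : ℤ) - 1) - 1 = m - ((t + 1 : ℕ) : ℤ) := by ring
      have s2 : (i : ℤ) - (((t + 1 : ℕ) : ℤ) - 1) = ((i + 1 : ℕ) : ℤ) - ((t + 1 : ℕ) : ℤ) := by
        push_cast; ring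
      have s3 : (i : ℤ) + 1 - ((t + 1 : ℕ) : ℤ) = ((i + 1 : ℕ) : ℤ) - ((t + 1 : ℕ) : ℤ) := by
        push_cast; ring
      have s4 : (((t + 1 : ℕ) : ℤ) - 1).toNat = t := by simp
      have s5 : (2 * (((t + 1 : ℕ) : ℤ) - 1) - m - i : ℤ) = 2 * t - m - i := by push_cast; ring
      have s6 : (2 * ((t + 1 : ℕ) : ℤ) - m - i - 2 : ℤ) = 2 * t - m - i := by push_cast; ring
      have s7 : h + ((2 * ((t + 1 : ℕ) : ℤ) - m - ((i + 1 : ℕ) : ℤ) : ℤ) : A)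
          = h + ((2 * t - m - i : ℤ) : A) + 1 := by push_cast; noncomm_ring
      rw [s1, s2, s3, s4, s5, s6, s7, Int.toNat_natCast, binom_add_one, ← add_mul, ← mul_add,
        ← smul_mul_assoc, ← mul_smul_comm]
      congr 2
      have b := succ_smul_binom_succ (h + ((2 * t - m - i : ℤ) : A)) t
      have cm := (commute_binom h (2 * t - m - i) t).eq
      set u := binom (h + ((2 * t - m - i : ℤ) : A)) t
      set v := binom (h + ((2 * t - m - i : ℤ) : A)) (t + 1)
      have e : ((i : ℂ) + 1 - ((((t + 1 : ℕ) : ℤ)) : ℂ)) • v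
          = ((i : ℂ) + 1) • v - ((t : ℂ) + 1) • v := by
        rw [← sub_smul]; push_cast; rfl
      rw [e, b, smul_add, sub_add, sub_eq_add_neg]
      congr 1
      rw [neg_sub, sub_eq_iff_eq_add]
      have d : ∀ z : ℤ, (z : A) * u = u * (z : A) := fun z => (Int.cast_commute z u).eq
      have f : ((i : ℂ) + 1) • u = u * ((i + 1 : ℤ) : A) := by
        rw [← d, ← zsmul_eq_mul, ← Int.cast_smul_eq_zsmul ℂ]; push_cast; rfl
      rw [f, ← mul_add, add_mul, sub_mul, cm, d, one_mul]
      push_cast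
      noncomm_ring

end Commutation

section Integral
variable {A : Type*} [Ring A] [Algebra ℂ A] {x y h : A}

theorem binom_mul_binom_mem (h : A) (c d : ℤ) (t n : ℕ) :
    binom (h + (c : A)) t * binom (h + (d : A)) n ∈ AddSubgroup.closure (Set.range (binom h)) := by
  set L := AddSubgroup.closure (Set.range (binom h))
  have hL : ∀ n, binom h n ∈ L := fun n => AddSubgroup.subset_closure ⟨n, rfl⟩
  have h1 : ∀ t, binom h t * binom (h + (d : A)) n ∈ L := by
    intro t
    have := binom_add_int_mem (L.comap (AddMonoidHom.mulLeft (binom h t))) (h - (t : A)) n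
      (fun i _ => by
        rw [AddSubgroup.mem_comap, AddMonoidHom.coe_mulLeft, binom_mul_binom_sub]
        exact L.zsmul_mem (hL _) _) (d + t) n le_rfl
    rw [AddSubgroup.mem_comap, AddMonoidHom.coe_mulLeft] at this
    convert this using 3
    push_cast; abel
  exact binom_add_int_mem (L.comap (AddMonoidHom.mulRight (binom (h + (d : A)) n))) h t
    (fun i _ => h1 i) c t le_rfl

/-- The product `y^(m) binom(h, n) x^(m')` attached to the triple `(m, n, m')`. -/
def pbw (y h x : A) (i : ℕ × ℕ × ℕ) : A := divPow y i.1 * binom h i.2.1 * divPow x i.2.2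

theorem divPow_mul_pbw_mem (hx : h * x = x * (h + ((2 : ℤ) : A)))
    (hy : h * y = y * (h + ((-2 : ℤ) : A))) (hxy : x * y = y * x + h) (j : ℕ) (i : ℕ × ℕ × ℕ) :
    divPow x j * pbw y h x i ∈ AddSubgroup.closure (Set.range (pbw y h x)) := by
  obtain ⟨m, n, m'⟩ := i
  set S := AddSubgroup.closure (Set.range (pbw y h x))
  have hS : ∀ i, pbw y h x i ∈ S := fun i => AddSubgroup.subset_closure ⟨i, rfl⟩
  have hmid : ∀ (a b : ℕ) (z : A), z ∈ AddSubgroup.closure (Set.range (binom h)) →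
      divPow y a * z * divPow x b ∈ S := by
    intro a b z hz
    have : AddSubgroup.closure (Set.range (binom h)) ≤ S.comap
        ((AddMonoidHom.mulRight (divPow x b)).comp (AddMonoidHom.mulLeft (divPow y a))) := by
      rw [AddSubgroup.closure_le]
      rintro _ ⟨n, rfl⟩
      exact hS (a, n, b)
    exact this hz
  simp only [pbw]
  rw [← mul_assoc, ← mul_assoc, commutation hx hy hxy, Finset.sum_mul, Finset.sum_mul]
  refine S.sum_mem fun t ht => ?_
  have ht : t ≤ j := by simpa [Nat.lt_succ_iff] using ht
  rcases lt_or_ge m t with hm | hm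
  · have : ((m : ℤ) - t) = Int.negSucc (t - m - 1) := by omega
    rw [this]
    simp [divPowZ]
  · rw [← Nat.cast_sub hm, ← Nat.cast_sub ht, divPowZ_natCast, divPowZ_natCast]
    have hc := semiconj_divPow hx (j - t)
    have hb := binom_semiconj hc (-(((j - t : ℕ) : ℤ) * 2)) n
    rw [neg_add_cancel, Int.cast_zero, add_zero] at hb
    rw [mul_assoc _ _ (binom h n), ← hb, mul_assoc, mul_assoc, mul_assoc, divPow_mul_divPow,
      mul_smul_comm, mul_smul_comm, mul_smul_comm, ← mul_assoc, ← mul_assoc, mul_assoc (divPow y _)]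
    exact S.zsmul_mem (hmid _ _ _ (binom_mul_binom_mem h _ _ _ _)) _

theorem divPow_mul_pbw_mem' (j : ℕ) (i : ℕ × ℕ × ℕ) :
    divPow y j * pbw y h x i ∈ AddSubgroup.closure (Set.range (pbw y h x)) := by
  obtain ⟨m, n, m'⟩ := i
  simp only [pbw]
  rw [← mul_assoc, ← mul_assoc, divPow_mul_divPow, smul_mul_assoc, smul_mul_assoc]
  have hmem : pbw y h x (j + m, n, m') ∈ AddSubgroup.closure (Set.range (pbw y h x)) :=
    AddSubgroup.subset_closure ⟨_, rfl⟩
  exact AddSubgroup.zsmul_mem _ hmem _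

theorem binom_mem_closure (hx : h * x = x * (h + ((2 : ℤ) : A)))
    (hy : h * y = y * (h + ((-2 : ℤ) : A))) (hxy : x * y = y * x + h) (c : ℤ) (n : ℕ) :
    binom (h + (c : A)) n ∈ Subring.closure (Set.range (divPow x) ∪ Set.range (divPow y)) := by
  set U := Subring.closure (Set.range (divPow x) ∪ Set.range (divPow y))
  have hX : ∀ m, divPow x m ∈ U := fun m => Subring.subset_closure (Or.inl ⟨m, rfl⟩)
  have hY : ∀ m, divPow y m ∈ U := fun m => Subring.subset_closure (Or.inr ⟨m, rfl⟩)
  have hXZ : ∀ m, divPowZ x m ∈ U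
    | (m : ℕ) => hX m
    | Int.negSucc _ => U.zero_mem
  have hYZ : ∀ m, divPowZ y m ∈ U
    | (m : ℕ) => hY m
    | Int.negSucc _ => U.zero_mem
  have key : ∀ n, binom h n ∈ U := by
    intro n
    induction n using Nat.strong_induction_on with
    | _ n ih =>
      have := commutation hx hy hxy n n
      rw [Finset.sum_range_succ] at this
      simp only [sub_self] at this
      rw [show (2 * n - n - n : ℤ) = 0 by ring, Int.cast_zero, add_zero,
        show divPowZ y 0 = 1 from divPow_zero y, show divPowZ x 0 = 1 from divPow_zero x,
        one_mul, mul_one] at this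
      rw [← sub_eq_of_eq_add' this]
      refine U.sub_mem (U.mul_mem (hX n) (hY n)) (U.sum_mem fun t ht => ?_)
      refine U.mul_mem (U.mul_mem (hYZ _) ?_) (hXZ _)
      have ht : t < n := by simpa using ht
      exact binom_add_int_mem U.toAddSubgroup h t (fun i hi => ih i (by omega)) _ t le_rfl
  exact binom_add_int_mem U.toAddSubgroup h n (fun i _ => key i) c n le_rfl

theorem closure_eq_span (hx : h * x = x * (h + ((2 : ℤ) : A)))
    (hy : h * y = y * (h + ((-2 : ℤ) : A))) (hxy : x * y = y * x + h) {z : A}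
    (hz : z ∈ Subring.closure (Set.range (divPow x) ∪ Set.range (divPow y))) :
    z ∈ AddSubgroup.closure (Set.range (pbw y h x)) := by
  set S := AddSubgroup.closure (Set.range (pbw y h x))
  have hone : (1 : A) ∈ S :=
    AddSubgroup.subset_closure ⟨(0, 0, 0), by simp [pbw, divPow_zero, binom_zero]⟩
  have lift : ∀ a : A, (∀ i, a * pbw y h x i ∈ S) → ∀ s ∈ S, a * s ∈ S := by
    intro a ha s hs
    have : S ≤ S.comap (AddMonoidHom.mulLeft a) := by
      rw [AddSubgroup.closure_le]
      rintro _ ⟨i, rfl⟩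
      exact ha i
    exact this hs
  have key : ∀ s ∈ S, z * s ∈ S := by
    induction hz using Subring.closure_induction with
    | mem a ha =>
      rcases ha with ⟨m, rfl⟩ | ⟨m, rfl⟩
      · exact lift _ (divPow_mul_pbw_mem hx hy hxy m)
      · exact lift _ (divPow_mul_pbw_mem' m)
    | zero => intro s _; simp [S.zero_mem]
    | one => intro s hs; simpa using hs
    | add a b _ _ ha hb => intro s hs; rw [add_mul]; exact S.add_mem (ha s hs) (hb s hs)
    | neg a _ ha => intro s hs; rw [neg_mul]; exact S.neg_mem (ha s hs)
    | mul a b _ _ ha hb => intro s hs; rw [mul_assoc]; exact ha _ (hb s hs)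
  simpa using key 1 hone

end Integral

section Enveloping

attribute [local instance] LieRing.ofAssociativeRing LieAlgebra.ofAssociativeAlgebra

/-- The universal enveloping algebra of `sl₂(ℂ)`. -/
abbrev UC : Type := UniversalEnvelopingAlgebra ℂ (LieAlgebra.SpecialLinear.sl (Fin 2) ℂ)

/-- The matrix `X = (0 1; 0 0)`. -/
def matX : LieAlgebra.SpecialLinear.sl (Fin 2) ℂ :=
  ⟨!![0, 1; 0, 0], by simp [LieAlgebra.SpecialLinear.sl]⟩

/-- The matrix `Y = (0 0; 1 0)`. -/
def matY : LieAlgebra.SpecialLinear.sl (Fin 2) ℂ :=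
  ⟨!![0, 0; 1, 0], by simp [LieAlgebra.SpecialLinear.sl]⟩

/-- The matrix `H = (1 0; 0 -1)`. -/
def matH : LieAlgebra.SpecialLinear.sl (Fin 2) ℂ :=
  ⟨!![1, 0; 0, -1], by simp [LieAlgebra.SpecialLinear.sl]⟩

def eX : UC := UniversalEnvelopingAlgebra.ι ℂ matX
def eY : UC := UniversalEnvelopingAlgebra.ι ℂ matY
def eH : UC := UniversalEnvelopingAlgebra.ι ℂ matH

theorem lie_HX : ⁅matH, matX⁆ = (2 : ℂ) • matX := by
  apply Subtype.ext
  ext i j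
  fin_cases i <;> fin_cases j <;>
    simp [matH, matX, LieRing.of_associative_ring_bracket]
  norm_num

theorem lie_HY : ⁅matH, matY⁆ = (-2 : ℂ) • matY := by
  apply Subtype.ext
  ext i j
  fin_cases i <;> fin_cases j <;>
    simp [matH, matY, LieRing.of_associative_ring_bracket]
  norm_num

theorem lie_XY : ⁅matX, matY⁆ = matH := by
  apply Subtype.ext
  ext i j
  fin_cases i <;> fin_cases j <;>
    simp [matH, matX, matY, LieRing.of_associative_ring_bracket]

theorem eH_mul_eX : eH * eX = eX * (eH + ((2 : ℤ) : UC)) := by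
  have := congrArg (UniversalEnvelopingAlgebra.ι ℂ) lie_HX
  rw [LieHom.map_lie, LieRing.of_associative_ring_bracket, map_smul] at this
  change eH * eX - eX * eH = (2 : ℂ) • eX at this
  rw [sub_eq_iff_eq_add] at this
  rw [this, mul_add, add_comm, two_smul]; push_cast; noncomm_ring

theorem eH_mul_eY : eH * eY = eY * (eH + ((-2 : ℤ) : UC)) := by
  have := congrArg (UniversalEnvelopingAlgebra.ι ℂ) lie_HY
  rw [LieHom.map_lie, LieRing.of_associative_ring_bracket, map_smul] at this
  change eH * eY - eY * eH = (-2 : ℂ) • eY at this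
  rw [sub_eq_iff_eq_add] at this
  rw [this, mul_add, add_comm, neg_smul, two_smul]; push_cast; noncomm_ring

theorem eX_mul_eY : eX * eY = eY * eX + eH := by
  have := congrArg (UniversalEnvelopingAlgebra.ι ℂ) lie_XY
  rw [LieHom.map_lie, LieRing.of_associative_ring_bracket] at this
  change eX * eY - eY * eX = eH at this
  rw [sub_eq_iff_eq_add] at this
  rw [this, add_comm]

/-- Raising operator of the generic Verma module (auxiliary). -/
def opX : Module.End ℂ (ℕ → ℂ[X]) where
  toFun f i := ((i : ℂ[X]) + 1) * (X - (i : ℂ[X])) * f (i + 1)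
  map_add' f g := by funext i; simp [mul_add]
  map_smul' c f := by funext i; simp

/-- Lowering operator of the generic Verma module (auxiliary). -/
def opY : Module.End ℂ (ℕ → ℂ[X]) where
  toFun f i := match i with
    | 0 => 0
    | i + 1 => f i
  map_add' f g := by funext i; cases i <;> simp
  map_smul' c f := by funext i; cases i <;> simp

/-- Weight operator of the generic Verma module (auxiliary). -/
def opH : Module.End ℂ (ℕ → ℂ[X]) where
  toFun f i := (X - 2 * (i : ℂ[X])) * f i
  map_add' f g := by funext i; simp [mul_add]
  map_smul' c f := by funext i; simp

/-- The generic Verma module as a representation (auxiliary). -/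
def verma : LieAlgebra.SpecialLinear.sl (Fin 2) ℂ →ₗ⁅ℂ⁆ Module.End ℂ (ℕ → ℂ[X]) where
  toFun a := a.1 0 0 • opH + a.1 0 1 • opX + a.1 1 0 • opY
  map_add' a b := by simp [add_smul]; abel
  map_smul' c a := by simp [mul_smul]
  map_lie' := by
    intro a b
    have ha : a.1 1 1 = - a.1 0 0 := by
      have := a.2
      simp [LieAlgebra.SpecialLinear.sl, Matrix.trace, Fin.sum_univ_two] at this
      linear_combination this
    have hb : b.1 1 1 = - b.1 0 0 := by
      have := b.2
      simp [LieAlgebra.SpecialLinear.sl, Matrix.trace, Fin.sum_univ_two] at this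
      linear_combination this
    refine LinearMap.ext fun f => funext fun i => ?_
    simp only [LieAlgebra.SpecialLinear.sl_bracket, Matrix.sub_apply, Matrix.mul_apply,
      Fin.sum_univ_two, ha, hb, LieRing.of_associative_ring_bracket, LinearMap.sub_apply,
      LinearMap.add_apply, LinearMap.smul_apply, Module.End.mul_apply, Pi.sub_apply, Pi.add_apply,
      Pi.smul_apply, map_add, map_smul, Polynomial.smul_eq_C_mul]
    rcases i with _ | _ | i <;> simp [opX, opY, opH] <;> ring

theorem verma_eX : UniversalEnvelopingAlgebra.lift ℂ verma eX = opX := by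
  rw [eX, UniversalEnvelopingAlgebra.lift_ι_apply]; simp [verma, matX]

theorem verma_eY : UniversalEnvelopingAlgebra.lift ℂ verma eY = opY := by
  rw [eY, UniversalEnvelopingAlgebra.lift_ι_apply]; simp [verma, matY]

theorem verma_eH : UniversalEnvelopingAlgebra.lift ℂ verma eH = opH := by
  rw [eH, UniversalEnvelopingAlgebra.lift_ι_apply]; simp [verma, matH]

theorem opX_single_zero (g : ℂ[X]) : opX (Pi.single 0 g) = 0 := by
  funext i; simp [opX]

theorem opX_single_succ (d : ℕ) (g : ℂ[X]) :
    opX (Pi.single (d + 1) g) = Pi.single d (((d : ℂ[X]) + 1) * (X - (d : ℂ[X])) * g) := by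
  funext i
  rcases eq_or_ne i d with rfl | hi
  · simp [opX]
  · simp [opX, Pi.single_eq_of_ne hi, Pi.single_eq_of_ne (show i + 1 ≠ d + 1 by omega)]

theorem opY_single (d : ℕ) (g : ℂ[X]) : opY (Pi.single d g) = Pi.single (d + 1) g := by
  funext i
  cases i with
  | zero => simp [opY]
  | succ i =>
    rcases eq_or_ne i d with rfl | hi
    · simp [opY]
    · simp [opY, Pi.single_eq_of_ne hi, Pi.single_eq_of_ne (show i + 1 ≠ d + 1 by omega)]

theorem opY_pow_single (m : ℕ) (g : ℂ[X]) : (opY ^ m) (Pi.single 0 g) = Pi.single m g := by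
  induction m with
  | zero => simp
  | succ m ih => rw [pow_succ', Module.End.mul_apply, ih, opY_single]

theorem opX_pow_single (d : ℕ) : ∀ g : ℂ[X], g ≠ 0 →
    ∃ q : ℂ[X], q ≠ 0 ∧ (opX ^ d) (Pi.single d g) = Pi.single 0 q := by
  induction d with
  | zero => intro g hg; exact ⟨g, hg, by simp⟩
  | succ d ih =>
    intro g hg
    rw [pow_succ]
    have h1 : (d : ℂ[X]) + 1 ≠ 0 := by exact_mod_cast Nat.succ_ne_zero d
    have h2 : (X : ℂ[X]) - (d : ℂ[X]) ≠ 0 := by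
      rw [← C_eq_natCast]; exact X_sub_C_ne_zero _
    obtain ⟨q, hq, e⟩ := ih _ (mul_ne_zero (mul_ne_zero h1 h2) hg)
    exact ⟨q, hq, by rw [Module.End.mul_apply, opX_single_succ, e]⟩

theorem opX_pow_single_of_lt {d j : ℕ} (hj : d < j) {g : ℂ[X]} (hg : g ≠ 0) :
    (opX ^ j) (Pi.single d g) = 0 := by
  obtain ⟨q, -, e⟩ := opX_pow_single d g hg
  obtain ⟨k, rfl⟩ : ∃ k, j = k + 1 + d := ⟨j - d - 1, by omega⟩
  rw [pow_add, Module.End.mul_apply, e, pow_succ, Module.End.mul_apply, opX_single_zero, map_zero]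

theorem aeval_opH_single (P g : ℂ[X]) :
    (aeval opH P) (Pi.single 0 g) = Pi.single 0 (P * g) := by
  have h : ∀ g : ℂ[X], opH (Pi.single 0 g) = Pi.single 0 (X * g) := by
    intro g; funext i
    rcases eq_or_ne i 0 with rfl | hi
    · simp [opH]
    · simp [opH, Pi.single_eq_of_ne hi]
  induction P using Polynomial.induction_on' generalizing g with
  | add p q hp hq => rw [map_add, LinearMap.add_apply, hp, hq, add_mul, Pi.single_add]
  | monomial n a =>
    rw [aeval_monomial, Module.End.mul_apply, Module.algebraMap_end_apply]
    have : (opH ^ n) (Pi.single 0 g) = Pi.single 0 (X ^ n * g) := by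
      induction n with
      | zero => simp
      | succ n ih => rw [pow_succ', Module.End.mul_apply, ih, h, pow_succ', mul_assoc]
    rw [this, ← Pi.single_smul, ← C_mul_X_pow_eq_monomial, Polynomial.smul_eq_C_mul, mul_assoc]

theorem linearIndependent_pbw_complex : LinearIndependent ℂ (pbw eY eH eX) := by
  rw [linearIndependent_iff]
  intro l hl
  by_contra hne
  obtain ⟨⟨m, n₀, d⟩, hi₀, hmin⟩ :=
    l.support.exists_min_image (fun i => i.2.2) (Finsupp.support_nonempty_iff.2 hne)
  obtain ⟨⟨m₁, n, d₁⟩, hi, hmax⟩ :=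
    (l.support.filter (fun i => i.1 = m ∧ i.2.2 = d)).exists_max_image (fun i => i.2.1)
      ⟨(m, n₀, d), by simpa using hi₀⟩
  clear hi₀
  rw [Finset.mem_filter] at hi
  obtain ⟨hi, rfl, rfl⟩ := hi
  simp only at hmin hmax hi
  obtain ⟨q, hq, e⟩ := opX_pow_single d₁ 1 one_ne_zero
  have h0 := congrArg (fun u => UniversalEnvelopingAlgebra.lift ℂ verma u
    (Pi.single d₁ (1 : ℂ[X])) m₁) hl
  have val : ∀ (m' n' d' : ℕ), d₁ ≤ d' →
      UniversalEnvelopingAlgebra.lift ℂ verma (pbw eY eH eX (m', n', d'))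
        (Pi.single d₁ (1 : ℂ[X])) m₁ = if m' = m₁ ∧ d' = d₁ then
          (((m₁ ! : ℂ)⁻¹ * (n' ! : ℂ)⁻¹ * (d₁ ! : ℂ)⁻¹) • (descPochhammer ℂ n' * q)) else 0 := by
    intro m' n' d' hd
    simp only [pbw, divPow, binom, map_mul, map_smul, map_pow, ← Polynomial.aeval_algHom_apply,
      verma_eX, verma_eY, verma_eH, Module.End.mul_apply, LinearMap.smul_apply]
    rcases hd.eq_or_lt with rfl | hd
    · rw [e, aeval_opH_single, opY_pow_single]
      by_cases hm : m' = m₁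
      · subst hm
        simp only [Pi.smul_apply, Pi.single_eq_same, smul_smul, and_self, if_true]
        congr 1; ring
      · simp [hm]
    · rw [opX_pow_single_of_lt hd one_ne_zero]
      simp [hd.ne']
  rw [Finsupp.linearCombination_apply, Finsupp.sum] at h0
  simp only [map_sum, map_smul, LinearMap.sum_apply, LinearMap.smul_apply, Finset.sum_apply,
    Pi.smul_apply, map_zero, LinearMap.zero_apply, Pi.zero_apply] at h0
  have h1 : (∑ i ∈ l.support, if i.1 = m₁ ∧ i.2.2 = d₁ then
      (l i * ((m₁ ! : ℂ)⁻¹ * (i.2.1 ! : ℂ)⁻¹ * (d₁ ! : ℂ)⁻¹)) • descPochhammer ℂ i.2.1 else 0)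
        * q = 0 := by
    refine Eq.trans ?_ h0
    rw [Finset.sum_mul]
    refine Finset.sum_congr rfl fun i hi' => ?_
    obtain ⟨m', n', d'⟩ := i
    rw [val m' n' d' (hmin _ hi')]
    split_ifs with hc
    · rw [smul_smul, smul_mul_assoc]
    · simp only [smul_zero, zero_mul]
  have h2 := congrArg (fun P => P.coeff n) ((mul_eq_zero.1 h1).resolve_right hq)
  simp only [finsetSum_coeff, coeff_zero] at h2
  rw [Finset.sum_eq_single (m₁, n, d₁)] at h2
  · have hc : (descPochhammer ℂ n).coeff n = 1 := by
      have := monic_descPochhammer ℂ n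
      rwa [Monic, leadingCoeff, descPochhammer_natDegree] at this
    simp only [and_self, if_true, coeff_smul, hc, smul_eq_mul, mul_one] at h2
    have f1 : ((m₁ ! : ℕ) : ℂ) ≠ 0 := by exact_mod_cast m₁.factorial_ne_zero
    have f2 : ((n ! : ℕ) : ℂ) ≠ 0 := by exact_mod_cast n.factorial_ne_zero
    have f3 : ((d₁ ! : ℕ) : ℂ) ≠ 0 := by exact_mod_cast d₁.factorial_ne_zero
    have : l (m₁, n, d₁) ≠ 0 := by simpa using hi
    simp [f1, f2, f3, this] at h2
  · rintro ⟨m', n', d'⟩ hi' hne'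
    by_cases hc : m' = m₁ ∧ d' = d₁
    · obtain ⟨rfl, rfl⟩ := hc
      have hle := hmax (m', n', d') (by simpa using hi')
      have hlt : n' < n := lt_of_le_of_ne hle (fun h => hne' (by rw [h]))
      simp only [and_self, if_true, coeff_smul]
      rw [coeff_eq_zero_of_natDegree_lt (by rwa [descPochhammer_natDegree]), smul_zero]
    · rw [if_neg hc]; simp
  · intro h; exact absurd hi h

end Enveloping
section IntegralForm

/-- The integral form `U_ℤ`: the subring of the enveloping algebra of `sl₂(ℂ)` generated by the
divided powers `X^(m)`, `Y^(m)`. -/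
def UZ : Subring UC := Subring.closure (Set.range (divPow eX) ∪ Set.range (divPow eY))

theorem divPow_eX_mem (m : ℕ) : divPow eX m ∈ UZ := Subring.subset_closure (Or.inl ⟨m, rfl⟩)

theorem divPow_eY_mem (m : ℕ) : divPow eY m ∈ UZ := Subring.subset_closure (Or.inr ⟨m, rfl⟩)

theorem eX_mem : eX ∈ UZ := by simpa [divPow_one] using divPow_eX_mem 1

theorem eY_mem : eY ∈ UZ := by simpa [divPow_one] using divPow_eY_mem 1

theorem binom_eH_mem (c : ℤ) (n : ℕ) : binom (eH + (c : UC)) n ∈ UZ :=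
  binom_mem_closure eH_mul_eX eH_mul_eY eX_mul_eY c n

theorem pbw_mem (i : ℕ × ℕ × ℕ) : pbw eY eH eX i ∈ UZ :=
  UZ.mul_mem (UZ.mul_mem (divPow_eY_mem _) (by simpa using binom_eH_mem 0 i.2.1))
    (divPow_eX_mem _)

/-- The elements `Y^(m) binom(H, n) X^(m')` of `U_ℤ`. -/
def pbwZ (i : ℕ × ℕ × ℕ) : UZ := ⟨pbw eY eH eX i, pbw_mem i⟩

theorem linearIndependent_pbwZ : LinearIndependent ℤ pbwZ := by
  have h : LinearIndependent ℤ (pbw eY eH eX) :=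
    linearIndependent_pbw_complex.restrict_scalars
      (by intro a b hab; simpa using hab)
  exact LinearIndependent.of_comp UZ.subtype.toIntAlgHom.toLinearMap h

theorem span_pbwZ : ⊤ ≤ Submodule.span ℤ (Set.range pbwZ) := by
  rintro ⟨z, hz⟩ -
  have h := closure_eq_span eH_mul_eX eH_mul_eY eX_mul_eY hz
  have h2 : AddSubgroup.closure (Set.range (pbw eY eH eX)) ≤
      ((Submodule.span ℤ (Set.range pbwZ)).map UZ.subtype.toIntAlgHom.toLinearMap).toAddSubgroup := by
    rw [AddSubgroup.closure_le]
    rintro _ ⟨i, rfl⟩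
    exact ⟨pbwZ i, Submodule.subset_span ⟨i, rfl⟩, rfl⟩
  obtain ⟨w, hw, e⟩ := h2 h
  have : w = ⟨z, hz⟩ := Subtype.ext e
  exact this ▸ hw

/-- The `ℤ`-basis `Y^(m) binom(H, n) X^(m')` of `U_ℤ`, indexed by `(m, n, m')`. -/
def basisZ : Module.Basis (ℕ × ℕ × ℕ) ℤ UZ := Module.Basis.mk linearIndependent_pbwZ span_pbwZ

end IntegralForm

section Hyperalgebra
variable (k : Type*) [Field k]

/-- The hyperalgebra `𝒰 = Dist(SL₂)` over `k`, i.e. the scalar extension of `U_ℤ` to `k`. -/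
abbrev Hyperalgebra : Type _ := k ⊗[ℤ] UZ

/-- The image of `X` in `𝒰`. -/
def genX : Hyperalgebra k := 1 ⊗ₜ ⟨eX, eX_mem⟩

/-- The image of `Y` in `𝒰`. -/
def genY : Hyperalgebra k := 1 ⊗ₜ ⟨eY, eY_mem⟩

/-- The image of `binom(H + c, n)` in `𝒰`, for an integer `c`. -/
def binomH (c : ℤ) (n : ℕ) : Hyperalgebra k := 1 ⊗ₜ ⟨binom (eH + (c : UC)) n, binom_eH_mem c n⟩

/-- The `k`-basis `Y^(m) binom(H, n) X^(m')` of `𝒰`, indexed by `(m, n, m')`. -/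
def basis : Module.Basis (ℕ × ℕ × ℕ) k (Hyperalgebra k) := Algebra.TensorProduct.basis k basisZ

/-- The basis vector at `(m, n, m')` is the image of `Y^(m) binom(H, n) X^(m')`. -/
theorem basis_apply (i : ℕ × ℕ × ℕ) : basis k i = 1 ⊗ₜ pbwZ i := by
  simp [basis, basisZ]

/-- The `k`-linear map `FrPrime` (that is, Fr-prime) sending `Y^(m) binom(H, n) X^(m')` to
`Y^(mp) binom(H, np) X^(m'p)`. -/
def FrPrime (p : ℕ) : Hyperalgebra k →ₗ[k] Hyperalgebra k :=
  (basis k).constr k fun i => basis k (i.1 * p, i.2.1 * p, i.2.2 * p)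

/-- `μ_a = binom(H - a - 1, p - 1)`. -/
def mu (p : ℕ) (a : ℤ) : Hyperalgebra k := binomH k (-a - 1) (p - 1)

end Hyperalgebra

section Elements
variable (p : ℕ) [Fact p.Prime]

/-- The set `𝒫` of pairs `(a, j)`. For odd `p` it is `{0, …, p - 1} × {0, …, (p - 1) / 2}`; for
`p = 2` it is `{(0, 1/2), (1, 0), (1, 1)}`. -/
def paramSet : Set (ℤ × ℚ) :=
  if p = 2 then {(0, 1 / 2), (1, 0), (1, 1)}
  else {q | 0 ≤ q.1 ∧ q.1 ≤ (p : ℤ) - 1 ∧ ∃ i : ℕ, i ≤ (p - 1) / 2 ∧ q.2 = (i : ℚ)}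

/-- `φ_{a,m}(x) = ∏_{i < m} (x - i (i + a + 1))`. -/
def phi (a : ℤ) (m : ℕ) : (ZMod p)[X] :=
  ∏ i ∈ Finset.range m, (X - C ((i : ZMod p) * ((i : ZMod p) + (a : ZMod p) + 1)))

/-- `ψ(x) = ∏_{i ∈ 𝔽_p} (x - i²)`. -/
def psi : (ZMod p)[X] := ∏ i : ZMod p, (X - C (i ^ 2))

/-- The polynomials `ψ_j^{(ε)}` for odd `p`, with `j` given by its image in `𝔽_p`:
`ψ_j^{(1)} = ψ / (x - j²)`, `ψ_0^{(0)} = ∏_{i ≠ 0} (x - i²)` and, for `j ≠ 0`,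
`ψ_j^{(0)} = 2 x (x + j²) ∏_{i ≠ 0, j, -j} (x - i²)`. -/
def psiE (ε : Fin 2) (j : ZMod p) : (ZMod p)[X] :=
  if ε = 1 then psi p /ₘ (X - C (j ^ 2))
  else if j = 0 then ∏ i ∈ Finset.univ.filter (fun i : ZMod p => i ≠ 0), (X - C (i ^ 2))
  else 2 * X * (X + C (j ^ 2)) *
    ∏ i ∈ Finset.univ.filter (fun i : ZMod p => i ≠ 0 ∧ i ≠ j ∧ i ≠ -j), (X - C (i ^ 2))

/-- The element `((a + 1) / 2)²` of `𝔽_p` (for odd `p`). -/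
def shift (a : ℤ) : ZMod p := (((a : ZMod p) + 1) / 2) ^ 2

/-- `n^{(ε)}(a, j)`: for odd `p` the largest `n` such that `φ_{a,n}(x)` divides
`ψ_j^{(ε)}(x + ((a + 1) / 2)²)`; for `p = 2` it is `1` at `(1, 0)`, `0` at `(1, 1)` and `ε` at
`(0, 1/2)`. -/
def nNum (ε : Fin 2) (a : ℤ) (j : ℚ) : ℕ :=
  if p = 2 then (if a = 1 then (if j = 0 then 1 else 0) else (ε : ℕ))
  else sSup {n : ℕ | phi p a n ∣ (psiE p ε (j.num : ZMod p)).comp (X + C (shift p a))}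

/-- Condition (A): `a` is even and `(p - a + 1) / 2 ≤ j ≤ (p - 1) / 2`. -/
def CondA (a : ℤ) (j : ℚ) : Prop :=
  Even a ∧ ((p : ℚ) - a + 1) / 2 ≤ j ∧ j ≤ ((p : ℚ) - 1) / 2

/-- Condition (C): `a` is odd and `0 ≤ j ≤ (a - 1) / 2`. -/
def CondC (a : ℤ) (j : ℚ) : Prop :=
  Odd a ∧ 0 ≤ j ∧ j ≤ ((a : ℚ) - 1) / 2

/-- The integer `s(a, j)`, used under (A) or (C): `(p - a + 1) / 2` for `p` odd and `a` even,
`(p - a) / 2` for `p` and `a` odd, and `1` for `p = 2`. -/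
def sNum (a : ℤ) : ℕ :=
  if p = 2 then 1
  else if Even a then (((p : ℤ) - a + 1) / 2).toNat else (((p : ℤ) - a) / 2).toNat

variable (k : Type*) [Field k] [CharP k p]

/-- The embedding of `𝔽_p` into `k`. -/
def emb : ZMod p →+* k := ZMod.castHom (dvd_refl p) k

/-- The element `B^{(ε)}(a, j)` of `𝒰` for a pair `(a, j)` in `𝒫`. For odd `p` it is
`ψ_j^{(ε)}(μ_a Y X + ((a + 1) / 2)²) μ_a`. For `p = 2` it is `μ_0` or `μ_0 Y X` at `(0, 1/2)`
(for `ε = 0` or `ε = 1`), `μ_1 Y X` at `(1, 0)` and `μ_1 Y X + μ_1` at `(1, 1)`. -/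
def B1 (ε : Fin 2) (a : ℤ) (j : ℚ) : Hyperalgebra k :=
  if p = 2 then
    if a = 0 then (if ε = 0 then mu k p 0 else mu k p 0 * genY k * genX k)
    else if j = 0 then mu k p 1 * genY k * genX k
    else mu k p 1 * genY k * genX k + mu k p 1
  else
    aeval (mu k p a * genY k * genX k + algebraMap k (Hyperalgebra k) (emb p k (shift p a)))
      ((psiE p ε (j.num : ZMod p)).map (emb p k)) * mu k p a

/-- The coefficients `c_m ∈ 𝔽_p` in the (unique) expansion
`B^{(ε)}(a, j) = μ_a ∑_{m = n^{(ε)}(a, j)}^{p - 1} c_m Y^m X^m`. -/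
def coeffs (ε : Fin 2) (a : ℤ) (j : ℚ) : ℕ → ZMod p :=
  Classical.epsilon fun c => B1 p k ε a j =
    mu k p a * ∑ m ∈ Finset.Icc (nNum p ε a j) (p - 1), emb p k (c m) • (genY k ^ m * genX k ^ m)

open scoped Classical in
/-- The map `z ↦ Z^{(ε)}(z; (a, j))`, given by
`μ_a ∑_m c_m Y^m X^{m - s(a, j)} Fr'(z) X^{s(a, j)}` if `(a, j)` satisfies (A) or (C), and by
`Fr'(z) B^{(ε)}(a, j)` for the remaining pairs of `𝒫`. In the first case every `m` in the sum
satisfies `m ≥ s(a, j)`. For `p = 2` only `(1, 0)` falls under the first case. -/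
def Z (ε : Fin 2) (a : ℤ) (j : ℚ) (z : Hyperalgebra k) : Hyperalgebra k :=
  if CondA p a j ∨ CondC a j then
    mu k p a * ∑ m ∈ Finset.Icc (nNum p ε a j) (p - 1), emb p k (coeffs p k ε a j m) •
      (genY k ^ m * genX k ^ (m - sNum p a) * FrPrime k p z * genX k ^ sNum p a)
  else FrPrime k p z * B1 p k ε a j

/-- The element `B^{(ε_0, …, ε_{r-1})}((a_0, …, a_{r-1}), (j_0, …, j_{r-1}))` of `𝒰`, for `r ≥ 1`
(the value at `r = 0` is irrelevant). -/
def B : (r : ℕ) → (Fin r → Fin 2) → (Fin r → ℤ) → (Fin r → ℚ) → Hyperalgebra k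
  | 0, _, _, _ => 1
  | 1, ε, a, j => B1 p k (ε 0) (a 0) (j 0)
  | r + 2, ε, a, j =>
    Z p k (ε 0) (a 0) (j 0) (B (r + 1) (Fin.tail ε) (Fin.tail a) (Fin.tail j))

end Elements
end SL2Hyper
end

/-! ### The polynomials at `j = 0` -/

namespace SL2Hyper
open Polynomial

/-! The element attached to a tuple is built by nesting: the innermost layer is a single `B1`, and
each further layer applies one map `Z`. The parameter `ε_s` is used only in layer `s`, so it is
enough to show that a single layer forgets its `ε` when `p` is odd and `j = 0`, or when `p = 2` and
`a = 1`.

For odd `p` the only source of `ε` in a layer is the polynomial `psiE`. A nonzero square `j²` is a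
double root of `ψ`, so dividing by `x - j²` leaves a factor `x - j²`, and this is genuinely
different from the polynomial with `ε = 0`, which carries `2 (x + j²)` in its place. The root `0` is
simple: dividing `ψ` by `x` leaves exactly the product over nonzero `i`, which is the polynomial for
`ε = 0`. Hence the two choices coincide at `j = 0` (`psiE_zero_right`). For `p = 2` and `a = 1` the
defining tables do not mention `ε` at all.

Equality of the polynomials, or of the table entries, passes to the lower summation bound, to the
element `B1`, then to the coefficients determined by these two, and so to the whole map (`Z_congr`).
Induction on the number of layers (`B_congr`) finishes the argument. No computation inside the
hyperalgebra is needed. -/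

theorem psi_divByMonic_X (p : ℕ) [Fact p.Prime] :
    psi p /ₘ X = ∏ i ∈ Finset.univ.filter (fun i : ZMod p => i ≠ 0), (X - C (i ^ 2)) := by
  have h : psi p = X * ∏ i ∈ Finset.univ.filter (fun i : ZMod p => i ≠ 0), (X - C (i ^ 2)) := by
    -- The factor at `i = 0` is `X - C (0 ^ 2) = X`; it is split off, and the erased set is the
    -- filtered one.
    rw [psi, ← Finset.mul_prod_erase _ _ (Finset.mem_univ (0 : ZMod p)), Finset.filter_ne']
    simp
  rw [h, mul_divByMonic_cancel_left _ monic_X]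

/-- For `j = 0` the polynomials `ψ_j^{(0)}` and `ψ_j^{(1)}` agree. -/
theorem psiE_zero_right (p : ℕ) [Fact p.Prime] (ε δ : Fin 2) : psiE p ε 0 = psiE p δ 0 := by
  have h : ∀ ε : Fin 2, psiE p ε 0 =
      ∏ i ∈ Finset.univ.filter (fun i : ZMod p => i ≠ 0), (X - C (i ^ 2)) := by
    intro ε
    unfold psiE
    split_ifs
    -- Here `ε = 1`, and the divisor `X - C (0 ^ 2)` simplifies to `X`. The next case is `ε = 0`,
    -- where the product is the definition; the last one would require `0 ≠ 0`.
    · simpa using psi_divByMonic_X p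
    · rfl
    · contradiction
  rw [h, h]

/-! ### Independence of `ε`, first for one layer and then for nested layers -/

section
variable (p : ℕ) [Fact p.Prime] (k : Type*) [Field k] [CharP k p] {a : ℤ} {j : ℚ}

/-- For odd `p` both sides are suprema of the same set of exponents, because the polynomial being
divided is the same. For `p = 2` only the entry with `a ≠ 1` reads `ε`. The hypothesis `h` describes
the layers that are blind to `ε` and recurs in all the lemmas below. -/
theorem nNum_congr (h : p ≠ 2 ∧ j = 0 ∨ p = 2 ∧ a = 1) (ε δ : Fin 2) :
    nNum p ε a j = nNum p δ a j := by
  rcases h with ⟨hp, rfl⟩ | ⟨rfl, rfl⟩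
  · simp [nNum, hp, psiE_zero_right p ε δ]
  · simp [nNum]

theorem B1_congr (h : p ≠ 2 ∧ j = 0 ∨ p = 2 ∧ a = 1) (ε δ : Fin 2) :
    B1 p k ε a j = B1 p k δ a j := by
  rcases h with ⟨hp, rfl⟩ | ⟨rfl, rfl⟩
  · simp [B1, hp, psiE_zero_right p ε δ]
  · simp [B1]

/-- The coefficients are chosen by `Classical.epsilon` from a predicate that sees `ε` only through
`B1` and `nNum`. Equal predicates give the same choice, so neither existence nor uniqueness of the
expansion is needed. -/
theorem coeffs_congr (h : p ≠ 2 ∧ j = 0 ∨ p = 2 ∧ a = 1) (ε δ : Fin 2) :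
    coeffs p k ε a j = coeffs p k δ a j := by
  simp only [coeffs, nNum_congr p h ε δ, B1_congr p k h ε δ]

/-- Conditions (A) and (C) and the shift `sNum` do not involve `ε`, so both sides fall in the same
case of the definition, and the previous lemmas cover all remaining ingredients. -/
theorem Z_congr (h : p ≠ 2 ∧ j = 0 ∨ p = 2 ∧ a = 1) (ε δ : Fin 2) (z : Hyperalgebra k) :
    Z p k ε a j z = Z p k δ a j z := by
  simp only [Z, nNum_congr p h ε δ, B1_congr p k h ε δ, coeffs_congr p k h ε δ]

/-- The recursion follows that of `B`. The hypothesis is imposed index by index, as "equal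
parameters or a blind layer", so that it restricts to tails. -/
theorem B_congr : ∀ (r : ℕ) (ε δ : Fin r → Fin 2) (a : Fin r → ℤ) (j : Fin r → ℚ),
    (∀ s, ε s = δ s ∨ (p ≠ 2 ∧ j s = 0 ∨ p = 2 ∧ a s = 1)) → B p k r ε a j = B p k r δ a j
  | 0, _, _, _, _, _ => rfl
  | 1, ε, δ, a, j, h => by
    rcases h 0 with h | h
    · simp only [B, h]
    · exact B1_congr p k h _ _
  | r + 2, ε, δ, a, j, h => by
    simp only [B]
    -- This makes the arguments of the two outer maps equal, leaving only the outermost parameter to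
    -- compare.
    rw [B_congr (r + 1) (Fin.tail ε) (Fin.tail δ) (Fin.tail a) (Fin.tail j) fun s => h s.succ]
    rcases h 0 with h | h
    · rw [h]
    · exact Z_congr p k h _ _ _

end
end SL2Hyper

/-! ### The proposition -/

theorem proposition3p6 (p : ℕ) [Fact p.Prime] (k : Type*) [Field k] [IsAlgClosed k] [CharP k p]
    (r : ℕ) (hr : 0 < r) (a : Fin r → ℤ) (j : Fin r → ℚ)
    (haj : ∀ s, (a s, j s) ∈ SL2Hyper.paramSet p) :
    (∀ ε δ : Fin r → Fin 2,
      (∀ s, ((Odd p ∧ j s ≠ 0) ∨ (p = 2 ∧ a s ≠ 1)) → ε s = δ s) →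
        SL2Hyper.B p k r ε a j = SL2Hyper.B p k r δ a j) ∧
    (∀ ε : Fin r → Fin 2,
      SL2Hyper.B p k r ε a j =
        SL2Hyper.B p k r
          (fun s => if (Odd p ∧ j s ≠ 0) ∨ (p = 2 ∧ a s ≠ 1) then ε s else 0) a j) := by
  have main : ∀ ε δ : Fin r → Fin 2,
      (∀ s, ((Odd p ∧ j s ≠ 0) ∨ (p = 2 ∧ a s ≠ 1)) → ε s = δ s) →
        SL2Hyper.B p k r ε a j = SL2Hyper.B p k r δ a j := by
    intro ε δ h
    refine SL2Hyper.B_congr p k r ε δ a j fun s => ?_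
    have hs := h s
    -- The implication in `hs` becomes the disjunction required by `B_congr`; a prime other than `2`
    -- is odd, which matches the two forms of the case distinction.
    rcases eq_or_ne p 2 with hp | hp
    · tauto
    · have hodd : Odd p := (Fact.out : p.Prime).odd_of_ne_two hp
      tauto
  -- The second claim is an instance of the first: the modified tuple keeps `ε s` at every index
  -- where agreement is required.
  refine ⟨main, fun ε => main _ _ fun s hs => ?_⟩
  rw [if_pos hs]
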